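/- \textbf{Lemma (Annulus with symmetry).} Let $0<\rho<1$, $r=\sqrt\rho$, $A_\rho=\{\zeta\in\mathbb C:\rho<|\zeta|<1\}$ and $\Gamma_s=\{\zeta\in\mathbb C:|\zeta|=s\}$. Let $\|f\|_{L^2(\Gamma_s)}$ be the $L^2$ norm with respect to arc length, and let $H^2(A_\rho)$ be the space of all $f$ analytic in $A_\rho$ with $\|f\|_{H^2(A_\rho)}=\sup_{\rho<s<1}\|f\|_{L^2(\Gamma_s)}<\infty$. Put $$\mathcal H=\{f\in H^2(A_\rho): f(\overline\zeta)=f(\zeta)\ \text{ for all } |\zeta|=r\}.$$ Let $z\in\mathbb C$ with $r<|z|<1$ and $\gamma(z)=\dfrac{\ln|z|}{\ln r}$. Then: (i) There exists $C>0$ such that for every $\epsilon>0$ and every $f\in\mathcal H$ with $\|f\|_{H^2(A_\rho)}\le 1$ and $\|f\|_{L^2(\Gamma_r)}\le\epsilon$, $$|f(z)|\le C\,\epsilon^{\gamma(z)}.$$ (ii) This bound is asymptotically optimal as $\epsilon\to0$: there exists $c>0$ such that for every $0<\epsilon\le1$ there is $f\in\mathcal H$ with $\|f\|_{H^2(A_\rho)}\le1$,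 $\|f\|_{L^2(\Gamma_r)}\le\epsilon$ and $|f(z)|\ge c\,\epsilon^{\gamma(z)}$. (iii) The bound is attained by the function $$M_\epsilon(\zeta)=\epsilon^{2-\gamma(z)}\sum_{n=1}^\infty\frac{\overline z^{\,n}+(\rho/\overline z)^n}{\rho^n+\epsilon^2}\left[\zeta^n+(\rho/\zeta)^n\right],\qquad \zeta\in A_\rho .$$ That is, for every $\epsilon>0$ the series converges absolutely at each $\zeta\in A_\rho$ and $M_\epsilon\in\mathcal H$; and there are constants $c',C'>0$ independent of $\epsilon$ such that for all $0<\epsilon\le1$ $$\|M_\epsilon\|_{H^2(A_\rho)}\le C',\qquad \|M_\epsilon\|_{L^2(\Gamma_r)}\le C'\epsilon,\qquad c'\epsilon^{\gamma(z)}\le|M_\epsilon(z)|\le C'\epsilon^{\gamma(z)} .$$ -/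

import Mathlib

noncomputable section

namespace AnnulusSymm

/-- The open annulus `{ζ : ρ < |ζ| < 1}`. -/
def annulus (ρ : ℝ) : Set ℂ := {ζ : ℂ | ρ < ‖ζ‖ ∧ ‖ζ‖ < 1}

/-- The norm of `f` in `L²` of the circle `|ζ| = s` with respect to arc length
`|dτ| = s dθ`, where `τ = s e^{iθ}` and `θ` ranges over `(0, 2π]`. Its value is in `[0, ∞]`. -/
def circleL2Norm (s : ℝ) (f : ℂ → ℂ) : ENNReal :=
  MeasureTheory.eLpNorm (fun θ : ℝ => f (circleMap 0 s θ)) 2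
    (ENNReal.ofReal s •
      (MeasureTheory.volume : MeasureTheory.Measure ℝ).restrict (Set.Ioc 0 (2 * Real.pi)))

/-- The Hardy norm on the annulus: the supremum over `ρ < s < 1` of the `L²` norms on the circles
`|ζ| = s`. Its value is in `[0, ∞]`. -/
def hardyNorm (ρ : ℝ) (f : ℂ → ℂ) : ENNReal :=
  ⨆ s ∈ Set.Ioo ρ 1, circleL2Norm s f

/-- The Hardy space `H²` of the annulus. Its elements are represented by total functions on `ℂ`,
whose values off the annulus play no role. -/
def hardySpace (ρ : ℝ) : Set (ℂ → ℂ) :=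
  {f | AnalyticOnNhd ℂ f (annulus ρ) ∧ hardyNorm ρ f < ⊤}

/-- The functions of the Hardy space with `f (conj ζ) = f ζ` on the circle `|ζ| = √ρ`. -/
def symHardySpace (ρ : ℝ) : Set (ℂ → ℂ) :=
  {f | f ∈ hardySpace ρ ∧ ∀ ζ : ℂ, ‖ζ‖ = √ρ → f (starRingEnd ℂ ζ) = f ζ}

/-- The exponent `ln |z| / ln r` with `r = √ρ`. -/
def exponent (ρ : ℝ) (z : ℂ) : ℝ := Real.log ‖z‖ / Real.log (√ρ)

/-- The `n`-th term of the series that defines the extremal function. -/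
def extremalTerm (ρ : ℝ) (z : ℂ) (ε : ℝ) (n : ℕ) (ζ : ℂ) : ℂ :=
  ((starRingEnd ℂ z) ^ n + ((ρ : ℂ) / starRingEnd ℂ z) ^ n) / ((ρ : ℂ) ^ n + (ε : ℂ) ^ 2) *
    (ζ ^ n + ((ρ : ℂ) / ζ) ^ n)

/-- The extremal function; the series runs over the indices `n + 1 ≥ 1`. -/
def extremal (ρ : ℝ) (z : ℂ) (ε : ℝ) (ζ : ℂ) : ℂ :=
  ((ε ^ (2 - exponent ρ z) : ℝ) : ℂ) * ∑' n : ℕ, extremalTerm ρ z ε (n + 1) ζ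

end AnnulusSymm

end

open MeasureTheory Metric
open scoped Real

namespace AnnulusSymm

/-! ### Geometric sums with a cut-off -/

/-! Both directions rest on one estimate: for `0 < a < 1`, the sum of `q ^ (a * n) / (q ^ n + δ)`
has order `δ ^ (a - 1)`, its mass concentrating where `q ^ n` crosses `δ` (`tsum_rpow_pow_div_le`,
`exists_le_rpow_pow_div`).

Upper bound: write `f z` by Cauchy's formula on `r < |w| < s`. The inner integral is `O(ε)`. The
outer one expands into the nonnegative Laurent terms of `f` at `z`. Each is independent of the
radius, so it is at most a constant times `|z| ^ n` (radius tending to `1`) and times `ε * (|z| / r)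
^ n` (radius `r`), hence times `ε * |z| ^ n / (r ^ n + ε)`. Since `|z| = r ^ γ`, summing gives `ε *
ε ^ (γ - 1)`.

Extremal function: if `|ζ|` and `ρ / |ζ|` are at most `t`, its terms are dominated by `(|z| * t) ^ n
/ (ρ ^ n + ε ^ 2)`. With `|z| * t = ρ ^ a` and `δ = ε ^ 2`, the prefactor `ε ^ (2 - γ)` turns the
sum into `ε ^ (2 * a - γ)`. At `ζ = z` all terms are nonnegative, so the crossover term alone gives
the lower bound. Dividing by a constant gives optimality. -/

theorem summable_pow_div_pow_add {b q δ : ℝ} (hb0 : 0 ≤ b) (hb1 : b < 1) (hq : 0 < q)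
    (hδ : 0 < δ) : Summable fun n : ℕ => b ^ n / (q ^ n + δ) := by
  refine Summable.of_nonneg_of_le (fun n => by positivity) (fun n => ?_)
    ((summable_geometric_of_lt_one hb0 hb1).div_const δ)
  gcongr
  have := pow_pos hq n
  linarith

/-- Split at `q ^ (N + 1) < δ ≤ q ^ N`. Up to `N`, drop `δ` from the denominator; beyond `N`, drop
`q ^ n`. Both parts then decay geometrically away from the crossover, where the size is at most `δ ^
(a - 1)`. -/
theorem tsum_rpow_pow_div_le {q a δ : ℝ} (hq0 : 0 < q) (hq1 : q < 1) (ha0 : 0 < a) (ha1 : a < 1)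
    (hδ0 : 0 < δ) (hδ1 : δ ≤ 1) :
    ∑' n : ℕ, (q ^ a) ^ n / (q ^ n + δ) ≤
      ((1 - q ^ (1 - a))⁻¹ + (1 - q ^ a)⁻¹) * δ ^ (a - 1) := by
  have hb0 : 0 < q ^ a := Real.rpow_pos_of_pos hq0 a
  have hb1 : q ^ a < 1 := Real.rpow_lt_one hq0.le hq1 ha0
  have hc0 : 0 < q ^ (1 - a) := Real.rpow_pos_of_pos hq0 _
  have hc1 : q ^ (1 - a) < 1 := Real.rpow_lt_one hq0.le hq1 (by linarith)
  have hD : 0 < δ ^ (a - 1) := Real.rpow_pos_of_pos hδ0 _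
  obtain ⟨N, hN1, hN2⟩ := exists_nat_pow_near_of_lt_one hδ0 hδ1 hq0 hq1
  have hs := summable_pow_div_pow_add hb0.le hb1 hq0 hδ0
  rw [← hs.sum_add_tsum_nat_add (N + 1), add_mul]
  refine add_le_add ?_ ?_
  -- Reversing the sum makes `k` the distance below the crossover, so the ratio is `q ^ (1 - a) <
  -- 1`.
  · rw [← Finset.sum_range_reflect]
    have hterm : ∀ k ∈ Finset.range (N + 1),
        (q ^ a) ^ (N + 1 - 1 - k) / (q ^ (N + 1 - 1 - k) + δ) ≤
          (q ^ (1 - a)) ^ k * δ ^ (a - 1) := by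
      intro k hk
      obtain ⟨m, rfl⟩ := Nat.exists_eq_add_of_le (Nat.lt_succ_iff.1 (Finset.mem_range.1 hk))
      have e : k + m + 1 - 1 - k = m := by omega
      rw [e]
      have hm := pow_pos hq0 m
      have hk := pow_pos hq0 k
      calc (q ^ a) ^ m / (q ^ m + δ) ≤ (q ^ a) ^ m / q ^ m := by gcongr; linarith
        _ = (q ^ (1 - a)) ^ k * (q ^ (k + m)) ^ (a - 1) := by
          rw [Real.rpow_pow_comm hq0.le, Real.rpow_pow_comm hq0.le, pow_add,
            Real.mul_rpow hk.le hm.le, ← mul_assoc, ← Real.rpow_add hk, Real.rpow_sub_one hm.ne']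
          simp
        _ ≤ (q ^ (1 - a)) ^ k * δ ^ (a - 1) := by
          gcongr _ * ?_
          exact Real.rpow_le_rpow_of_nonpos hδ0 hN2 (by linarith)
    refine (Finset.sum_le_sum hterm).trans ?_
    rw [← Finset.sum_mul, ← tsum_geometric_of_lt_one hc0.le hc1]
    gcongr
    exact (summable_geometric_of_lt_one hc0.le hc1).sum_le_tsum _ fun n _ => by positivity
  · rw [← tsum_geometric_of_lt_one hb0.le hb1, ← tsum_mul_right]
    refine ((summable_nat_add_iff (N + 1)).2 hs).tsum_le_tsum (fun k => ?_)
      ((summable_geometric_of_lt_one hb0.le hb1).mul_right _)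
    have hk := pow_pos hq0 (k + (N + 1))
    calc (q ^ a) ^ (k + (N + 1)) / (q ^ (k + (N + 1)) + δ)
        ≤ (q ^ a) ^ (k + (N + 1)) / δ := by gcongr; linarith
      _ = (q ^ a) ^ k * ((q ^ (N + 1)) ^ a / δ) := by
          rw [pow_add, Real.rpow_pow_comm hq0.le a (N + 1), mul_div_assoc]
      _ ≤ (q ^ a) ^ k * (δ ^ a / δ) := by gcongr
      _ = (q ^ a) ^ k * δ ^ (a - 1) := by rw [Real.rpow_sub_one hδ0.ne']

/-- The first term past the crossover has denominator at most `2 * δ`. The index is `n + 1` because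
the extremal series starts at `1`. -/
theorem exists_le_rpow_pow_div {q a δ : ℝ} (hq0 : 0 < q) (hq1 : q < 1) (ha0 : 0 < a)
    (hδ0 : 0 < δ) (hδ1 : δ ≤ 1) :
    ∃ n : ℕ, q ^ a / 2 * δ ^ (a - 1) ≤ (q ^ a) ^ (n + 1) / (q ^ (n + 1) + δ) := by
  obtain ⟨N, hN1, hN2⟩ := exists_nat_pow_near_of_lt_one hδ0 hδ1 hq0 hq1
  have hb0 : 0 < q ^ a := Real.rpow_pos_of_pos hq0 a
  refine ⟨N, ?_⟩
  have hk := pow_pos hq0 (N + 1)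
  calc q ^ a / 2 * δ ^ (a - 1) = (q ^ a * δ ^ a) / (2 * δ) := by
        rw [Real.rpow_sub_one hδ0.ne']; ring
    _ ≤ (q ^ a) ^ (N + 1) / (2 * δ) := by
        rw [pow_succ', Real.rpow_pow_comm hq0.le a N]
        gcongr
    _ ≤ _ := by gcongr; linarith

/-! ### The norm on a circle -/

/-- The circle has length at most `2 * π`, and its square root is replaced by `2 * π ≥ 1` for
simplicity. -/
theorem circleL2Norm_le_of_bound {s B : ℝ} {f : ℂ → ℂ} (hs0 : 0 ≤ s) (hs : s ≤ 1)
    (h : ∀ ζ : ℂ, ‖ζ‖ = s → ‖f ζ‖ ≤ B) :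
    circleL2Norm s f ≤ ENNReal.ofReal (2 * π * B) := by
  unfold circleL2Norm
  refine (eLpNorm_le_of_ae_bound (C := B) (Filter.Eventually.of_forall fun θ => h _ ?_)).trans ?_
  · simp [abs_of_nonneg hs0]
  rw [ENNReal.ofReal_mul (by positivity)]
  gcongr
  have h1 : (1 : ENNReal) ≤ ENNReal.ofReal (2 * π) := by
    rw [ENNReal.one_le_ofReal]; linarith [Real.pi_gt_three]
  calc _ ≤ (ENNReal.ofReal (2 * π)) ^ (ENNReal.toReal 2)⁻¹ := by
        gcongr
        simp only [Measure.smul_apply, Measure.restrict_apply MeasurableSet.univ, Set.univ_inter,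
          Real.volume_Ioc, sub_zero, smul_eq_mul]
        exact mul_le_of_le_one_left' (by simpa using hs)
    _ ≤ _ := by
        conv_rhs => rw [← ENNReal.rpow_one (ENNReal.ofReal (2 * π))]
        exact ENNReal.rpow_le_rpow_of_exponent_le h1 (by norm_num)

/-- Cauchy–Schwarz against the constant `1`. -/
theorem mul_integral_norm_le {s B : ℝ} {f : ℂ → ℂ} (hs0 : 0 < s) (hs : s ≤ 1) (hB : 0 ≤ B)
    (hf : ContinuousOn f (sphere 0 s)) (h : circleL2Norm s f ≤ ENNReal.ofReal B) :
    s * ∫ θ in (0 : ℝ)..2 * π, ‖f (circleMap 0 s θ)‖ ≤ 2 * π * B := by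
  have hc : Continuous fun θ : ℝ => f (circleMap 0 s θ) :=
    hf.comp_continuous (continuous_circleMap 0 s) fun θ => circleMap_mem_sphere 0 hs0.le θ
  have h2 := eLpNorm_le_eLpNorm_mul_rpow_measure_univ (p := 1) (q := 2)
    (μ := ENNReal.ofReal s • volume.restrict (Set.Ioc 0 (2 * π))) (by norm_num)
    hc.aestronglyMeasurable
  rw [eLpNorm_one_smul_measure, eLpNorm_one_eq_lintegral_enorm,
    ← ofReal_integral_norm_eq_lintegral_enorm
      ((hc.intervalIntegrable 0 (2 * π)).1), ← ENNReal.ofReal_mul hs0.le] at h2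
  have h1 : (1 : ENNReal) ≤ ENNReal.ofReal (2 * π) := by
    rw [ENNReal.one_le_ofReal]; linarith [Real.pi_gt_three]
  rw [intervalIntegral.integral_of_le (by positivity)]
  rw [← ENNReal.ofReal_le_ofReal_iff (by positivity)]
  refine h2.trans ?_
  rw [mul_comm (2 * π) B, ENNReal.ofReal_mul hB]
  gcongr
  · exact h
  calc _ ≤ (ENNReal.ofReal (2 * π)) ^ (1 / ENNReal.toReal 1 - 1 / ENNReal.toReal 2) := by
        refine ENNReal.rpow_le_rpow ?_ (by norm_num)
        simp only [Measure.smul_apply, Measure.restrict_apply MeasurableSet.univ, Set.univ_inter,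
          Real.volume_Ioc, sub_zero, smul_eq_mul]
        exact mul_le_of_le_one_left' (by simpa using hs)
    _ ≤ _ := by
        conv_rhs => rw [← ENNReal.rpow_one (ENNReal.ofReal (2 * π))]
        exact ENNReal.rpow_le_rpow_of_exponent_le h1 (by norm_num)

theorem norm_circleIntegral_le {s A B : ℝ} {f g : ℂ → ℂ} (hs0 : 0 < s) (hs : s ≤ 1)
    (hA : 0 ≤ A) (hB : 0 ≤ B) (hf : ContinuousOn f (sphere 0 s))
    (h : circleL2Norm s f ≤ ENNReal.ofReal B) (hg : ∀ w ∈ sphere (0 : ℂ) s, ‖g w‖ ≤ A * ‖f w‖) :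
    ‖∮ w in C(0, s), g w‖ ≤ 2 * π * A * B := by
  have hc : Continuous fun θ : ℝ => f (circleMap 0 s θ) :=
    hf.comp_continuous (continuous_circleMap 0 s) fun θ => circleMap_mem_sphere 0 hs0.le θ
  calc ‖∮ w in C(0, s), g w‖
      ≤ ∫ θ in (0 : ℝ)..2 * π, s * (A * ‖f (circleMap 0 s θ)‖) := by
        refine intervalIntegral.norm_integral_le_of_norm_le (by positivity)
          (Filter.Eventually.of_forall fun θ _ => ?_)
          ((continuous_const.mul (continuous_const.mul hc.norm)).intervalIntegrable _ _)
        rw [norm_smul, deriv_circleMap]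
        simp only [norm_mul, norm_circleMap_zero, Complex.norm_I, mul_one, abs_of_pos hs0]
        gcongr
        exact hg _ (circleMap_mem_sphere 0 hs0.le θ)
    _ = A * (s * ∫ θ in (0 : ℝ)..2 * π, ‖f (circleMap 0 s θ)‖) := by
        rw [intervalIntegral.integral_const_mul, intervalIntegral.integral_const_mul]; ring
    _ ≤ A * (2 * π * B) := by
        exact mul_le_mul_of_nonneg_left (mul_integral_norm_le hs0 hs hB hf h) hA
    _ = 2 * π * A * B := by ring

/-! ### The extremal function -/

theorem isOpen_annulus (ρ : ℝ) : IsOpen (annulus ρ) :=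
  (isOpen_lt continuous_const continuous_norm).inter (isOpen_lt continuous_norm continuous_const)

theorem exponent_pos {ρ : ℝ} {z : ℂ} (hρ0 : 0 < ρ) (hρ1 : ρ < 1) (hz : √ρ < ‖z‖)
    (hz1 : ‖z‖ < 1) : 0 < exponent ρ z :=
  div_pos_of_neg_of_neg (Real.log_neg ((Real.sqrt_nonneg ρ).trans_lt hz) hz1)
    (Real.log_neg (Real.sqrt_pos.2 hρ0) (by rw [Real.sqrt_lt' one_pos]; simpa using hρ1))

theorem exponent_lt_one {ρ : ℝ} {z : ℂ} (hρ0 : 0 < ρ) (hρ1 : ρ < 1) (hz : √ρ < ‖z‖) :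
    exponent ρ z < 1 := by
  have hr : Real.log (√ρ) < 0 :=
    Real.log_neg (Real.sqrt_pos.2 hρ0) (by rw [Real.sqrt_lt' one_pos]; simpa using hρ1)
  rw [exponent, div_lt_one_of_neg hr]
  exact Real.log_lt_log (Real.sqrt_pos.2 hρ0) hz

theorem sqrt_rpow_exponent {ρ : ℝ} {z : ℂ} (hρ0 : 0 < ρ) (hρ1 : ρ < 1) (hz : √ρ < ‖z‖) :
    √ρ ^ exponent ρ z = ‖z‖ := by
  have hr : Real.log (√ρ) < 0 :=
    Real.log_neg (Real.sqrt_pos.2 hρ0) (by rw [Real.sqrt_lt' one_pos]; simpa using hρ1)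
  rw [Real.rpow_def_of_pos (Real.sqrt_pos.2 hρ0), exponent, mul_div_cancel₀ _ hr.ne,
    Real.exp_log ((Real.sqrt_nonneg ρ).trans_lt hz)]

theorem rpow_exponent_div_two {ρ : ℝ} {z : ℂ} (hρ0 : 0 < ρ) (hρ1 : ρ < 1) (hz : √ρ < ‖z‖) :
    ρ ^ (exponent ρ z / 2) = ‖z‖ := by
  rw [← sqrt_rpow_exponent hρ0 hρ1 hz, Real.sqrt_eq_rpow, ← Real.rpow_mul hρ0.le]
  congr 1
  ring

theorem div_norm_le_of_sqrt_lt {ρ : ℝ} {z : ℂ} (hz : √ρ < ‖z‖) :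
    ρ / ‖z‖ < ‖z‖ := by
  have h0 : 0 < ‖z‖ := (Real.sqrt_nonneg ρ).trans_lt hz
  rw [div_lt_iff₀ h0, ← sq]
  exact (Real.sqrt_lt' h0).1 hz

theorem norm_pow_add_div_pow_le {ρ t : ℝ} (hρ0 : 0 ≤ ρ) {ζ : ℂ} (h1 : ‖ζ‖ ≤ t)
    (h2 : ρ / ‖ζ‖ ≤ t) (n : ℕ) : ‖ζ ^ n + ((ρ : ℂ) / ζ) ^ n‖ ≤ 2 * t ^ n := by
  refine (norm_add_le _ _).trans ?_
  rw [norm_pow, norm_pow, norm_div, Complex.norm_real, Real.norm_of_nonneg hρ0, two_mul]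
  gcongr

theorem norm_extremalTerm_le {ρ ε t : ℝ} {z ζ : ℂ} (hρ0 : 0 < ρ) (hz : √ρ < ‖z‖) (hε : 0 < ε)
    (h1 : ‖ζ‖ ≤ t) (h2 : ρ / ‖ζ‖ ≤ t) (n : ℕ) :
    ‖extremalTerm ρ z ε n ζ‖ ≤ 4 * ((‖z‖ * t) ^ n / (ρ ^ n + ε ^ 2)) := by
  have hd : (ρ : ℂ) ^ n + (ε : ℂ) ^ 2 = ((ρ ^ n + ε ^ 2 : ℝ) : ℂ) := by push_cast; rfl
  have hp : 0 < ρ ^ n + ε ^ 2 := by positivity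
  rw [extremalTerm, norm_mul, norm_div, hd, Complex.norm_real, Real.norm_of_nonneg hp.le]
  have hz' : ‖(starRingEnd ℂ) z ^ n + ((ρ : ℂ) / (starRingEnd ℂ) z) ^ n‖ ≤ 2 * ‖z‖ ^ n :=
    norm_pow_add_div_pow_le hρ0.le (by simp)
      (by simpa using (div_norm_le_of_sqrt_lt hz).le) n
  calc _ ≤ 2 * ‖z‖ ^ n / (ρ ^ n + ε ^ 2) * (2 * t ^ n) := by
        gcongr
        exact norm_pow_add_div_pow_le hρ0.le h1 h2 n
    _ = _ := by rw [mul_pow]; ring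

theorem summable_extremalBound {ρ ε t : ℝ} {z : ℂ} (hρ0 : 0 < ρ) (hz1 : ‖z‖ < 1) (hε : 0 < ε)
    (ht0 : 0 ≤ t) (ht1 : t ≤ 1) :
    Summable fun n : ℕ => 4 * ((‖z‖ * t) ^ n / (ρ ^ n + ε ^ 2)) :=
  (summable_pow_div_pow_add (by positivity)
    (mul_lt_one_of_nonneg_of_lt_one_left (norm_nonneg z) hz1 ht1) hρ0 (by positivity)).mul_left 4

theorem summable_extremalTerm {ρ ε t : ℝ} {z ζ : ℂ} (hρ0 : 0 < ρ) (hz : √ρ < ‖z‖) (hz1 : ‖z‖ < 1)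
    (hε : 0 < ε) (h1 : ‖ζ‖ ≤ t) (h2 : ρ / ‖ζ‖ ≤ t) (ht1 : t ≤ 1) :
    Summable fun n : ℕ => extremalTerm ρ z ε (n + 1) ζ :=
  (summable_nat_add_iff 1).2 <| .of_norm_bounded
    (summable_extremalBound hρ0 hz1 hε ((norm_nonneg ζ).trans h1) ht1)
    fun n => norm_extremalTerm_le hρ0 hz hε h1 h2 n

theorem norm_extremal_le {ρ ε t : ℝ} {z ζ : ℂ} (hρ0 : 0 < ρ) (hz : √ρ < ‖z‖) (hz1 : ‖z‖ < 1)
    (hε : 0 < ε) (h1 : ‖ζ‖ ≤ t) (h2 : ρ / ‖ζ‖ ≤ t) (ht1 : t ≤ 1) :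
    ‖extremal ρ z ε ζ‖ ≤
      ε ^ (2 - exponent ρ z) * (4 * ∑' n : ℕ, (‖z‖ * t) ^ n / (ρ ^ n + ε ^ 2)) := by
  have ht0 : 0 ≤ t := (norm_nonneg ζ).trans h1
  have hs := summable_extremalBound (z := z) hρ0 hz1 hε ht0 ht1
  have hp : 0 < ε ^ (2 - exponent ρ z) := Real.rpow_pos_of_pos hε _
  rw [extremal, norm_mul, Complex.norm_real, Real.norm_of_nonneg hp.le, ← tsum_mul_left]
  gcongr
  refine (tsum_of_norm_bounded ((summable_nat_add_iff 1).2 hs).hasSum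
    fun n => norm_extremalTerm_le hρ0 hz hε h1 h2 (n + 1)).trans ?_
  -- The bound sums from index `0`, the series from `1`; the extra term is nonnegative.
  rw [hs.tsum_eq_zero_add]
  exact le_add_of_nonneg_left (by positivity)

theorem div_norm_le_one_of_mem_annulus {ρ : ℝ} {ζ : ℂ} (hρ0 : 0 < ρ) (hζ : ζ ∈ annulus ρ) :
    ρ / ‖ζ‖ ≤ 1 := (div_le_one (hρ0.trans hζ.1)).2 hζ.1.le

theorem analyticOnNhd_extremal {ρ ε : ℝ} {z : ℂ} (hρ0 : 0 < ρ) (hz : √ρ < ‖z‖) (hz1 : ‖z‖ < 1)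
    (hε : 0 < ε) : AnalyticOnNhd ℂ (extremal ρ z ε) (annulus ρ) := by
  refine DifferentiableOn.analyticOnNhd ?_ (isOpen_annulus ρ)
  refine DifferentiableOn.const_mul ?_ _
  refine Complex.differentiableOn_tsum_of_summable_norm ((summable_nat_add_iff 1).2
    (summable_extremalBound hρ0 hz1 hε zero_le_one le_rfl)) (fun n ζ hζ => ?_)
    (isOpen_annulus ρ) fun n ζ hζ =>
      norm_extremalTerm_le hρ0 hz hε hζ.2.le (div_norm_le_one_of_mem_annulus hρ0 hζ) (n + 1)
  have h0 : ζ ≠ 0 := norm_pos_iff.1 (hρ0.trans hζ.1)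
  refine DifferentiableAt.differentiableWithinAt ?_
  refine DifferentiableAt.const_mul ?_ _
  fun_prop (disch := assumption)

theorem hardyNorm_le_of_bound {ρ B : ℝ} {f : ℂ → ℂ} (hρ0 : 0 ≤ ρ)
    (h : ∀ ζ ∈ annulus ρ, ‖f ζ‖ ≤ B) : hardyNorm ρ f ≤ ENNReal.ofReal (2 * π * B) :=
  iSup₂_le fun _ hs => circleL2Norm_le_of_bound (hρ0.trans hs.1.le) hs.2.le
    fun ζ hζ => h ζ ⟨hζ ▸ hs.1, hζ ▸ hs.2⟩

/-- On this circle `ρ / ζ` is the conjugate of `ζ`, so conjugation swaps the two summands of each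
term. -/
theorem extremal_conj {ρ ε : ℝ} {z ζ : ℂ} (hρ0 : 0 < ρ) (hζ : ‖ζ‖ = √ρ) :
    extremal ρ z ε (starRingEnd ℂ ζ) = extremal ρ z ε ζ := by
  have hm : ζ * starRingEnd ℂ ζ = ρ := by
    rw [Complex.mul_conj, Complex.normSq_eq_norm_sq, hζ, Real.sq_sqrt hρ0.le]
  have h0 : ζ ≠ 0 := norm_pos_iff.1 (hζ ▸ Real.sqrt_pos.2 hρ0)
  have h0' : starRingEnd ℂ ζ ≠ 0 := (map_ne_zero _).2 h0
  have e1 : (ρ : ℂ) / ζ = starRingEnd ℂ ζ := by rw [← hm]; field_simp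
  have e2 : (ρ : ℂ) / starRingEnd ℂ ζ = ζ := by rw [← hm]; field_simp
  simp only [extremal, extremalTerm, e1, e2, add_comm]

theorem extremal_mem_symHardySpace {ρ ε : ℝ} {z : ℂ} (hρ0 : 0 < ρ) (hz : √ρ < ‖z‖)
    (hz1 : ‖z‖ < 1) (hε : 0 < ε) : extremal ρ z ε ∈ symHardySpace ρ :=
  ⟨⟨analyticOnNhd_extremal hρ0 hz hz1 hε, (hardyNorm_le_of_bound hρ0.le fun _ hζ =>
    norm_extremal_le hρ0 hz hz1 hε hζ.2.le (div_norm_le_one_of_mem_annulus hρ0 hζ)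
      le_rfl).trans_lt ENNReal.ofReal_lt_top⟩, fun _ hζ => extremal_conj hρ0 hζ⟩

theorem exists_norm_extremal_le {ρ t a : ℝ} {z : ℂ} (hρ0 : 0 < ρ) (hρ1 : ρ < 1) (hz : √ρ < ‖z‖)
    (hz1 : ‖z‖ < 1) (ht1 : t ≤ 1) (ha0 : 0 < a) (ha1 : a < 1) (ha : ρ ^ a = ‖z‖ * t) :
    ∃ K : ℝ, 0 < K ∧ ∀ ε : ℝ, 0 < ε → ε ≤ 1 → ∀ ζ : ℂ, ‖ζ‖ ≤ t → ρ / ‖ζ‖ ≤ t →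
      ‖extremal ρ z ε ζ‖ ≤ K * ε ^ (2 * a - exponent ρ z) := by
  have hb1 : ρ ^ a < 1 := Real.rpow_lt_one hρ0.le hρ1 ha0
  have hc1 : ρ ^ (1 - a) < 1 := Real.rpow_lt_one hρ0.le hρ1 (by linarith)
  have hb : 0 < (1 - ρ ^ a)⁻¹ := inv_pos.2 (by linarith)
  have hc : 0 < (1 - ρ ^ (1 - a))⁻¹ := inv_pos.2 (by linarith)
  refine ⟨4 * ((1 - ρ ^ (1 - a))⁻¹ + (1 - ρ ^ a)⁻¹), by positivity, fun ε hε hε1 ζ h1 h2 => ?_⟩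
  refine (norm_extremal_le hρ0 hz hz1 hε h1 h2 ht1).trans ?_
  have hp : 0 < ε ^ (2 - exponent ρ z) := Real.rpow_pos_of_pos hε _
  rw [← ha]
  have hsum := tsum_rpow_pow_div_le hρ0 hρ1 ha0 ha1 (sq_pos_of_pos hε) (pow_le_one₀ hε.le hε1)
  calc _ ≤ ε ^ (2 - exponent ρ z) *
        (4 * (((1 - ρ ^ (1 - a))⁻¹ + (1 - ρ ^ a)⁻¹) * (ε ^ 2) ^ (a - 1))) := by gcongr
    _ = 4 * ((1 - ρ ^ (1 - a))⁻¹ + (1 - ρ ^ a)⁻¹) *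
        (ε ^ (2 - exponent ρ z) * (ε ^ 2) ^ (a - 1)) := by ring
    _ = _ := by
        rw [← Real.rpow_natCast ε 2, ← Real.rpow_mul hε.le, ← Real.rpow_add hε]
        congr 2
        push_cast
        ring

/-- Rules out cancellation at `z`: any single term bounds the sum from below. -/
theorem extremalTerm_self (ρ : ℝ) (z : ℂ) (ε : ℝ) (n : ℕ) :
    extremalTerm ρ z ε n z =
      ((‖z ^ n + ((ρ : ℂ) / z) ^ n‖ ^ 2 / (ρ ^ n + ε ^ 2) : ℝ) : ℂ) := by
  have : (starRingEnd ℂ) z ^ n + ((ρ : ℂ) / (starRingEnd ℂ) z) ^ n =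
      starRingEnd ℂ (z ^ n + ((ρ : ℂ) / z) ^ n) := by simp
  rw [extremalTerm, this, div_mul_eq_mul_div, Complex.conj_mul']
  push_cast
  rfl

theorem le_norm_pow_add_div_pow {ρ : ℝ} {z : ℂ} (hρ0 : 0 < ρ) (hz : √ρ < ‖z‖) (n : ℕ) :
    (1 - ρ / ‖z‖ ^ 2) * ‖z‖ ^ (n + 1) ≤ ‖z ^ (n + 1) + ((ρ : ℂ) / z) ^ (n + 1)‖ := by
  have h0 : 0 < ‖z‖ := (Real.sqrt_nonneg ρ).trans_lt hz
  have h := norm_sub_le_norm_add (z ^ (n + 1)) (((ρ : ℂ) / z) ^ (n + 1))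
  rw [norm_pow, norm_pow, norm_div, Complex.norm_real, Real.norm_of_nonneg hρ0.le] at h
  refine le_trans ?_ h
  have h1 : (ρ / ‖z‖) ^ n ≤ ‖z‖ ^ n := by
    gcongr
    exact (div_norm_le_of_sqrt_lt hz).le
  have h2 : ρ / ‖z‖ ^ 2 * ‖z‖ ^ (n + 1) = ‖z‖ ^ n * (ρ / ‖z‖) := by
    field_simp
    ring
  rw [sub_mul, one_mul, h2, pow_succ (ρ / ‖z‖)]
  gcongr

theorem exists_le_norm_extremal_self {ρ : ℝ} {z : ℂ} (hρ0 : 0 < ρ) (hρ1 : ρ < 1) (hz : √ρ < ‖z‖)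
    (hz1 : ‖z‖ < 1) : ∃ c : ℝ, 0 < c ∧ ∀ ε : ℝ, 0 < ε → ε ≤ 1 →
      c * ε ^ exponent ρ z ≤ ‖extremal ρ z ε z‖ := by
  have h0 : 0 < ‖z‖ := (Real.sqrt_nonneg ρ).trans_lt hz
  have hw : 0 < 1 - ρ / ‖z‖ ^ 2 := by
    rw [sub_pos, div_lt_one (by positivity)]
    exact (Real.sqrt_lt' h0).1 hz
  have hq : 0 < ρ ^ exponent ρ z := Real.rpow_pos_of_pos hρ0 _
  have hqz : ρ ^ exponent ρ z = ‖z‖ ^ 2 := by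
    rw [← rpow_exponent_div_two hρ0 hρ1 hz, ← Real.rpow_natCast, ← Real.rpow_mul hρ0.le]
    congr 1
    push_cast
    ring
  refine ⟨(1 - ρ / ‖z‖ ^ 2) ^ 2 * (ρ ^ exponent ρ z / 2), by positivity, fun ε hε hε1 => ?_⟩
  have hp : 0 < ε ^ (2 - exponent ρ z) := Real.rpow_pos_of_pos hε _
  have hs := summable_extremalTerm hρ0 hz hz1 hε le_rfl (div_norm_le_of_sqrt_lt hz).le hz1.le
  obtain ⟨N, hN⟩ := exists_le_rpow_pow_div hρ0 hρ1 (exponent_pos hρ0 hρ1 hz hz1)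
    (sq_pos_of_pos hε) (pow_le_one₀ hε.le hε1)
  have hterm : (1 - ρ / ‖z‖ ^ 2) ^ 2 * ((ρ ^ exponent ρ z) ^ (N + 1) / (ρ ^ (N + 1) + ε ^ 2)) ≤
      ‖z ^ (N + 1) + ((ρ : ℂ) / z) ^ (N + 1)‖ ^ 2 / (ρ ^ (N + 1) + ε ^ 2) := by
    rw [hqz, ← mul_div_assoc, ← pow_mul, mul_comm 2, pow_mul, ← mul_pow]
    gcongr
    exact le_norm_pow_add_div_pow hρ0 hz N
  simp only [extremalTerm_self] at hs
  have hs' := Complex.summable_ofReal.1 hs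
  have hle := hs'.le_tsum N fun n _ => by positivity
  rw [extremal, norm_mul, Complex.norm_real, Real.norm_of_nonneg hp.le]
  simp only [extremalTerm_self]
  rw [← Complex.ofReal_tsum, Complex.norm_real]
  refine le_trans ?_ (mul_le_mul_of_nonneg_left
    ((mul_le_mul_of_nonneg_left hN (sq_nonneg (1 - ρ / ‖z‖ ^ 2))).trans
      (hterm.trans (hle.trans (Real.le_norm_self _)))) hp.le)
  refine le_of_eq ?_
  have he : ε ^ exponent ρ z = ε ^ (2 - exponent ρ z) * (ε ^ 2) ^ (exponent ρ z - 1) := by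
    rw [← Real.rpow_natCast ε 2, ← Real.rpow_mul hε.le, ← Real.rpow_add hε]
    congr 1
    push_cast
    ring
  rw [he]
  ring

theorem exists_extremal_bounds {ρ : ℝ} {z : ℂ} (hρ0 : 0 < ρ) (hρ1 : ρ < 1) (hz : √ρ < ‖z‖)
    (hz1 : ‖z‖ < 1) : ∃ c C : ℝ, 0 < c ∧ 0 < C ∧ ∀ ε : ℝ, 0 < ε → ε ≤ 1 →
      hardyNorm ρ (extremal ρ z ε) ≤ ENNReal.ofReal C ∧
      circleL2Norm (√ρ) (extremal ρ z ε) ≤ ENNReal.ofReal (C * ε) ∧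
      c * ε ^ exponent ρ z ≤ ‖extremal ρ z ε z‖ ∧
      ‖extremal ρ z ε z‖ ≤ C * ε ^ exponent ρ z := by
  have hg0 := exponent_pos hρ0 hρ1 hz hz1
  have hg1 := exponent_lt_one hρ0 hρ1 hz
  have hzp := rpow_exponent_div_two hρ0 hρ1 hz
  have hr1 : √ρ ≤ 1 := Real.sqrt_le_one.2 hρ1.le
  obtain ⟨c, hc, hlow⟩ := exists_le_norm_extremal_self hρ0 hρ1 hz hz1
  -- The choices `t = 1`, `√ρ`, `‖z‖` give `2 * a - γ = 0`, `1`, `γ` respectively.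
  obtain ⟨K₁, hK₁, h₁⟩ := exists_norm_extremal_le (a := exponent ρ z / 2) hρ0 hρ1 hz hz1 le_rfl
    (by linarith) (by linarith) (by rw [hzp, mul_one])
  obtain ⟨K₂, hK₂, h₂⟩ := exists_norm_extremal_le (a := exponent ρ z / 2 + 1 / 2) hρ0 hρ1 hz hz1
    hr1 (by linarith) (by linarith) (by rw [Real.rpow_add hρ0, hzp, Real.sqrt_eq_rpow])
  obtain ⟨K₃, hK₃, h₃⟩ := exists_norm_extremal_le (a := exponent ρ z / 2 + exponent ρ z / 2)
    hρ0 hρ1 hz hz1 hz1.le (by linarith) (by linarith) (by rw [Real.rpow_add hρ0, hzp])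
  have hpi := Real.pi_pos
  refine ⟨c, 2 * π * K₁ + 2 * π * K₂ + K₃, hc, by positivity, fun ε hε hε1 => ⟨?_, ?_,
    hlow ε hε hε1, ?_⟩⟩
  · refine (hardyNorm_le_of_bound (B := K₁) hρ0.le fun ζ hζ => ?_).trans
      (ENNReal.ofReal_le_ofReal (by nlinarith))
    refine (h₁ ε hε hε1 ζ hζ.2.le (div_norm_le_one_of_mem_annulus hρ0 hζ)).trans_eq ?_
    rw [show 2 * (exponent ρ z / 2) - exponent ρ z = 0 by ring, Real.rpow_zero, mul_one]
  · refine (circleL2Norm_le_of_bound (B := K₂ * ε) (Real.sqrt_nonneg ρ) hr1 fun ζ hζ => ?_).trans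
      (ENNReal.ofReal_le_ofReal ?_)
    · refine (h₂ ε hε hε1 ζ hζ.le (by rw [hζ, Real.div_sqrt])).trans_eq ?_
      rw [show 2 * (exponent ρ z / 2 + 1 / 2) - exponent ρ z = 1 by ring, Real.rpow_one]
    · rw [← mul_assoc]
      gcongr
      nlinarith
  · have hp : 0 < ε ^ exponent ρ z := Real.rpow_pos_of_pos hε _
    refine (h₃ ε hε hε1 z le_rfl (div_norm_le_of_sqrt_lt hz).le).trans ?_
    rw [show 2 * (exponent ρ z / 2 + exponent ρ z / 2) - exponent ρ z = exponent ρ z by ring]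
    gcongr
    nlinarith

/-! ### Rescaling -/

theorem circleL2Norm_const_mul (s : ℝ) (f : ℂ → ℂ) (k : ℂ) :
    circleL2Norm s (fun ζ => k * f ζ) = ‖k‖ₑ * circleL2Norm s f :=
  eLpNorm_const_smul k (fun θ : ℝ => f (circleMap 0 s θ)) 2 _

theorem hardyNorm_const_mul (ρ : ℝ) (f : ℂ → ℂ) (k : ℂ) :
    hardyNorm ρ (fun ζ => k * f ζ) = ‖k‖ₑ * hardyNorm ρ f := by
  simp only [hardyNorm, circleL2Norm_const_mul, ENNReal.mul_iSup]

theorem const_mul_mem_symHardySpace {ρ : ℝ} {f : ℂ → ℂ} (hf : f ∈ symHardySpace ρ) (k : ℂ) :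
    (fun ζ => k * f ζ) ∈ symHardySpace ρ :=
  ⟨⟨fun ζ hζ => analyticAt_const.mul (hf.1.1 ζ hζ), by
    rw [hardyNorm_const_mul]
    exact ENNReal.mul_lt_top enorm_lt_top hf.1.2⟩, fun ζ hζ => by simp only [hf.2 ζ hζ]⟩

theorem exists_mem_symHardySpace_of_extremal_bounds {ρ ε c C : ℝ} {z : ℂ} (hρ0 : 0 < ρ)
    (hz : √ρ < ‖z‖) (hz1 : ‖z‖ < 1) (hε : 0 < ε) (hC : 0 < C)
    (h1 : hardyNorm ρ (extremal ρ z ε) ≤ ENNReal.ofReal C)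
    (h2 : circleL2Norm (√ρ) (extremal ρ z ε) ≤ ENNReal.ofReal (C * ε))
    (h3 : c * ε ^ exponent ρ z ≤ ‖extremal ρ z ε z‖) :
    ∃ f ∈ symHardySpace ρ, hardyNorm ρ f ≤ 1 ∧ circleL2Norm (√ρ) f ≤ ENNReal.ofReal ε ∧
      C⁻¹ * c * ε ^ exponent ρ z ≤ ‖f z‖ := by
  have hk : ‖((C⁻¹ : ℝ) : ℂ)‖ = C⁻¹ := by
    rw [Complex.norm_real, Real.norm_of_nonneg (by positivity)]
  have hk' : ‖((C⁻¹ : ℝ) : ℂ)‖ₑ = ENNReal.ofReal C⁻¹ := by rw [← ofReal_norm, hk]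
  refine ⟨fun ζ => ((C⁻¹ : ℝ) : ℂ) * extremal ρ z ε ζ,
    const_mul_mem_symHardySpace (extremal_mem_symHardySpace hρ0 hz hz1 hε) _, ?_, ?_, ?_⟩
  · rw [hardyNorm_const_mul, hk']
    calc _ ≤ ENNReal.ofReal C⁻¹ * ENNReal.ofReal C := by gcongr
      _ = 1 := by
        rw [← ENNReal.ofReal_mul (by positivity), inv_mul_cancel₀ hC.ne', ENNReal.ofReal_one]
  · rw [circleL2Norm_const_mul, hk']
    calc _ ≤ ENNReal.ofReal C⁻¹ * ENNReal.ofReal (C * ε) := by gcongr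
      _ = ENNReal.ofReal ε := by
        rw [← ENNReal.ofReal_mul (by positivity), inv_mul_cancel_left₀ hC.ne']
  · rw [norm_mul, hk, mul_assoc]
    gcongr

/-! ### The Cauchy formula on an annulus -/

theorem closedBall_diff_ball_subset_annulus {ρ r s : ℝ} (hr : ρ < r) (hs : s < 1) :
    closedBall (0 : ℂ) s \ ball 0 r ⊆ annulus ρ := by
  rintro w ⟨h1, h2⟩
  rw [mem_closedBall_zero_iff] at h1
  rw [mem_ball_zero_iff, not_lt] at h2
  exact ⟨hr.trans_le h2, h1.trans_lt hs⟩

theorem sphere_subset_annulus {ρ s : ℝ} (hr : ρ < s) (hs : s < 1) :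
    sphere (0 : ℂ) s ⊆ annulus ρ := by
  intro w hw
  rw [mem_sphere_zero_iff_norm] at hw
  exact ⟨hw ▸ hr, hw ▸ hs⟩

theorem circleIntegral_eq_of_annulus {ρ r s : ℝ} {f : ℂ → ℂ} (hr0 : 0 < r) (hr : ρ < r)
    (hrs : r ≤ s) (hs : s < 1) (hf : DifferentiableOn ℂ f (annulus ρ)) :
    ∮ w in C(0, s), f w = ∮ w in C(0, r), f w := by
  have hsub := closedBall_diff_ball_subset_annulus hr hs
  refine Complex.circleIntegral_eq_of_differentiable_on_annulus_off_countable hr0 hrs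
    Set.countable_empty (hf.continuousOn.mono hsub) fun w hw => ?_
  exact hf.differentiableAt ((isOpen_annulus ρ).mem_nhds
    (hsub ⟨ball_subset_closedBall hw.1.1, fun h => hw.1.2 (ball_subset_closedBall h)⟩))

/-- The difference quotient `dslope f z` is continuous at `z`, so its integrals over the two circles
agree. Splitting it leaves the integral of `(w - z)⁻¹`, which is `2 * π * I` outside and `0` inside.
-/
theorem two_pi_I_mul_eq_sub_circleIntegral {ρ r s : ℝ} {f : ℂ → ℂ} {z : ℂ} (hr0 : 0 < r)
    (hr : ρ < r) (hrz : r < ‖z‖) (hzs : ‖z‖ < s) (hs : s < 1)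
    (hf : DifferentiableOn ℂ f (annulus ρ)) :
    2 * π * Complex.I * f z =
      (∮ w in C(0, s), (w - z)⁻¹ * f w) - ∮ w in C(0, r), (w - z)⁻¹ * f w := by
  have hsub := closedBall_diff_ball_subset_annulus hr hs
  have hzA : z ∈ annulus ρ := ⟨hr.trans hrz, hzs.trans hs⟩
  have hd : DifferentiableAt ℂ f z := hf.differentiableAt ((isOpen_annulus ρ).mem_nhds hzA)
  have hslope : ∮ w in C(0, s), dslope f z w = ∮ w in C(0, r), dslope f z w := by
    refine Complex.circleIntegral_eq_of_differentiable_on_annulus_off_countable hr0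
      (hrz.trans hzs).le (Set.countable_singleton z)
      (((continuousOn_dslope ((isOpen_annulus ρ).mem_nhds hzA)).2
        ⟨hf.continuousOn, hd⟩).mono hsub) fun w hw => ?_
    rw [differentiableAt_dslope_of_ne hw.2]
    exact hf.differentiableAt ((isOpen_annulus ρ).mem_nhds
      (hsub ⟨ball_subset_closedBall hw.1.1, fun h => hw.1.2 (ball_subset_closedBall h)⟩))
  have hexp : ∀ t : ℝ, 0 < t → ρ < t → t < 1 → ‖z‖ ≠ t →
      ∮ w in C(0, t), dslope f z w =
        (∮ w in C(0, t), (w - z)⁻¹ * f w) - (∮ w in C(0, t), (w - z)⁻¹) * f z := by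
    intro t ht0 ht ht1 hzt
    have hne : ∀ w ∈ sphere (0 : ℂ) t, w ≠ z := by
      rintro w hw rfl
      exact hzt (mem_sphere_zero_iff_norm.1 hw)
    have hinv : ContinuousOn (fun w : ℂ => (w - z)⁻¹) (sphere 0 t) :=
      ContinuousOn.inv₀ (by fun_prop) fun w hw => sub_ne_zero.2 (hne w hw)
    have hfc := hf.continuousOn.mono (sphere_subset_annulus ht ht1)
    have h1 : CircleIntegrable (fun w => (w - z)⁻¹ * f w) 0 t :=
      (hinv.mul hfc).circleIntegrable ht0.le
    have h2 : CircleIntegrable (fun w => (w - z)⁻¹ * f z) 0 t :=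
      (hinv.mul continuousOn_const).circleIntegrable ht0.le
    have h3 : (∮ w in C(0, t), (w - z)⁻¹) * f z = ∮ w in C(0, t), (w - z)⁻¹ * f z := by
      simpa only [smul_eq_mul] using
        (circleIntegral.integral_smul_const (fun w : ℂ => (w - z)⁻¹) (f z) 0 t).symm
    rw [h3, ← circleIntegral.integral_sub h1 h2]
    refine circleIntegral.integral_congr ht0.le fun w hw => ?_
    simp only [dslope_of_ne f (hne w hw), slope, vsub_eq_sub, smul_eq_mul, mul_sub]
  have hs0 : 0 < s := hr0.trans (hrz.trans hzs)
  have hzero : ∮ w in C(0, r), (w - z)⁻¹ = 0 := by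
    refine Complex.circleIntegral_eq_zero_of_differentiable_on_off_countable hr0.le
      Set.countable_empty (ContinuousOn.inv₀ (by fun_prop) fun w hw => ?_) fun w hw => ?_
    · rintro h
      rw [sub_eq_zero.1 h, mem_closedBall_zero_iff] at hw
      exact hrz.not_ge hw
    · refine DifferentiableAt.inv (by fun_prop) fun h => ?_
      have := hw.1
      rw [sub_eq_zero.1 h, mem_ball_zero_iff] at this
      exact hrz.not_gt this
  have hone : ∮ w in C(0, s), (w - z)⁻¹ = 2 * π * Complex.I :=
    circleIntegral.integral_sub_inv_of_mem_ball (mem_ball_zero_iff.2 hzs)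
  rw [hexp s hs0 (hr.trans (hrz.trans hzs)) hs hzs.ne,
    hexp r hr0 hr ((hrz.trans hzs).trans hs) hrz.ne', hzero, hone] at hslope
  linear_combination -hslope

/-! ### The upper bound -/

theorem norm_cauchyCoeff_le {r ε : ℝ} {f : ℂ → ℂ} {z : ℂ} (n : ℕ) (hr0 : 0 < r) (hr1 : r ≤ 1)
    (hε : 0 ≤ ε) (hf : ContinuousOn f (sphere 0 r)) (h : circleL2Norm r f ≤ ENNReal.ofReal ε) :
    ‖∮ w in C(0, r), (z / w) ^ n * (w⁻¹ * f w)‖ ≤ 2 * π * ((‖z‖ / r) ^ n * r⁻¹) * ε := by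
  refine norm_circleIntegral_le hr0 hr1 (by positivity) hε hf h fun w hw => ?_
  rw [mem_sphere_zero_iff_norm] at hw
  simp only [norm_mul, norm_pow, norm_div, norm_inv, hw, mul_assoc, le_refl]

theorem circleL2Norm_le_of_hardyNorm_le {ρ s : ℝ} {f : ℂ → ℂ} (h : hardyNorm ρ f ≤ 1)
    (hs : ρ < s) (hs1 : s < 1) : circleL2Norm s f ≤ ENNReal.ofReal 1 := by
  rw [ENNReal.ofReal_one]
  exact (le_iSup₂ (f := fun t (_ : t ∈ Set.Ioo ρ 1) => circleL2Norm t f) s ⟨hs, hs1⟩).trans h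

/-- Move the contour to radius `s` and let `s` increase to `1`, which removes the factor `s⁻¹ ^ (n +
1)`. -/
theorem norm_cauchyCoeff_le_of_hardyNorm_le {ρ r : ℝ} {f : ℂ → ℂ} {z : ℂ} (n : ℕ) (hr0 : 0 < r)
    (hr : ρ < r) (hr1 : r < 1) (hρ : 0 < ρ) (hf : DifferentiableOn ℂ f (annulus ρ))
    (h : hardyNorm ρ f ≤ 1) :
    ‖∮ w in C(0, r), (z / w) ^ n * (w⁻¹ * f w)‖ ≤ 2 * π * ‖z‖ ^ n := by
  have hd : DifferentiableOn ℂ (fun w => (z / w) ^ n * (w⁻¹ * f w)) (annulus ρ) := by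
    have h0 : ∀ w ∈ annulus ρ, w ≠ 0 := fun w hw => norm_pos_iff.1 (hρ.trans hw.1)
    exact (((differentiableOn_const z).div differentiableOn_id h0).pow n).mul
      ((differentiableOn_id.inv h0).mul hf)
  have hlim : Filter.Tendsto (fun s : ℝ => 2 * π * ((‖z‖ / s) ^ n * s⁻¹) * 1)
      (nhdsWithin 1 (Set.Iio 1))
      (nhds (2 * π * ((‖z‖ / 1) ^ n * 1⁻¹) * 1)) := by
    refine ContinuousAt.continuousWithinAt (f := fun s : ℝ => 2 * π * ((‖z‖ / s) ^ n * s⁻¹) * 1) ?_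
    fun_prop (disch := norm_num)
  simp only [div_one, inv_one, mul_one] at hlim
  refine ge_of_tendsto hlim ?_
  filter_upwards [Ioo_mem_nhdsLT hr1] with s hs
  rw [← circleIntegral_eq_of_annulus hr0 hr hs.1.le hs.2 hd]
  simpa using norm_cauchyCoeff_le (z := z) n (hr0.trans hs.1) hs.2.le zero_le_one
    (hf.continuousOn.mono (sphere_subset_annulus (hr.trans hs.1) hs.2))
    (circleL2Norm_le_of_hardyNorm_le h (hr.trans hs.1) hs.2)

/-- Merges the two coefficient bounds into the cut-off form of the geometric sums. -/
theorem min_one_div_le {u ε : ℝ} (hu : 0 < u) (hε : 0 < ε) :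
    min 1 (ε / u) ≤ 2 * ε / (u + ε) := by
  rcases le_total u ε with h | h
  · refine (min_le_left _ _).trans ?_
    rw [le_div_iff₀ (by positivity)]
    linarith
  · refine (min_le_right _ _).trans ?_
    rw [div_le_div_iff₀ hu (by positivity)]
    nlinarith

theorem norm_cauchyCoeff_le_div {ρ r ε : ℝ} {f : ℂ → ℂ} {z : ℂ} (n : ℕ) (hr0 : 0 < r)
    (hr : ρ < r) (hr1 : r < 1) (hρ : 0 < ρ) (hε : 0 < ε) (hf : DifferentiableOn ℂ f (annulus ρ))
    (h : hardyNorm ρ f ≤ 1) (hfε : circleL2Norm r f ≤ ENNReal.ofReal ε) :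
    ‖∮ w in C(0, r), (z / w) ^ n * (w⁻¹ * f w)‖ ≤
      2 * π * r⁻¹ * (2 * ε) * (‖z‖ ^ n / (r ^ n + ε)) := by
  have h1 := norm_cauchyCoeff_le_of_hardyNorm_le (z := z) n hr0 hr hr1 hρ hf h
  have h2 := norm_cauchyCoeff_le (z := z) n hr0 hr1.le hε.le
    (hf.continuousOn.mono (sphere_subset_annulus hr hr1)) hfε
  have hinv : 1 ≤ r⁻¹ := (one_le_inv₀ hr0).2 hr1.le
  have hrn : 0 < r ^ n := pow_pos hr0 n
  calc _ ≤ 2 * π * r⁻¹ * ‖z‖ ^ n * min 1 (ε / r ^ n) := by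
        rw [mul_min_of_nonneg _ _ (by positivity), le_min_iff]
        constructor
        · refine h1.trans ?_
          rw [mul_one]
          exact mul_le_mul_of_nonneg_right (le_mul_of_one_le_right (by positivity) hinv)
            (by positivity)
        · refine h2.trans_eq ?_
          rw [div_pow]
          ring
    _ ≤ 2 * π * r⁻¹ * ‖z‖ ^ n * (2 * ε / (r ^ n + ε)) := by
        gcongr
        exact min_one_div_le hrn hε
    _ = _ := by ring

theorem norm_le_of_hardyNorm_le {ρ r ε : ℝ} {f : ℂ → ℂ} {z : ℂ} (hr0 : 0 < r)
    (hr : ρ < r) (hrz : r < ‖z‖) (hz1 : ‖z‖ < 1) (hρ : 0 < ρ) (hε : 0 < ε)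
    (hf : DifferentiableOn ℂ f (annulus ρ))
    (h : hardyNorm ρ f ≤ 1) (hfε : circleL2Norm r f ≤ ENNReal.ofReal ε) :
    ‖f z‖ ≤ 2 * r⁻¹ * (ε * ∑' n : ℕ, ‖z‖ ^ n / (r ^ n + ε)) + (‖z‖ - r)⁻¹ * ε := by
  have hr1 : r < 1 := hrz.trans hz1
  obtain ⟨s, hzs, hs⟩ := exists_between hz1
  have hs0 : 0 < s := hr0.trans (hrz.trans hzs)
  have hfr := hf.continuousOn.mono (sphere_subset_annulus hr hr1)
  have hfs := hf.continuousOn.mono (sphere_subset_annulus (hr.trans (hrz.trans hzs)) hs)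
  have hinner : ‖∮ w in C(0, r), (w - z)⁻¹ * f w‖ ≤ 2 * π * (‖z‖ - r)⁻¹ * ε := by
    have hp : 0 < ‖z‖ - r := sub_pos.2 hrz
    refine norm_circleIntegral_le hr0 hr1.le (by positivity) hε.le hfr hfε fun w hw => ?_
    rw [mem_sphere_zero_iff_norm] at hw
    rw [norm_mul, norm_inv]
    gcongr
    rw [← hw, norm_sub_rev]
    exact norm_sub_norm_le z w
  -- Geometric expansion of the Cauchy kernel in `z / w` on the outer circle.
  have hsum := hasSum_two_pi_I_cauchyPowerSeries_integral (hfs.circleIntegrable hs0.le) hzs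
  simp only [sub_zero, zero_add, smul_eq_mul] at hsum
  have hd : ∀ n : ℕ, DifferentiableOn ℂ (fun w => (z / w) ^ n * (w⁻¹ * f w)) (annulus ρ) := by
    have h0 : ∀ w ∈ annulus ρ, w ≠ 0 := fun w hw => norm_pos_iff.1 (hρ.trans hw.1)
    exact fun n => (((differentiableOn_const z).div differentiableOn_id h0).pow n).mul
      ((differentiableOn_id.inv h0).mul hf)
  have houter : ‖∮ w in C(0, s), (w - z)⁻¹ * f w‖ ≤
      2 * π * r⁻¹ * (2 * ε) * ∑' n : ℕ, ‖z‖ ^ n / (r ^ n + ε) := by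
    refine hsum.norm_le_of_bounded
      ((summable_pow_div_pow_add (norm_nonneg z) hz1 hr0 hε).hasSum.mul_left _) fun n => ?_
    rw [circleIntegral_eq_of_annulus hr0 hr (hrz.trans hzs).le hs (hd n)]
    exact norm_cauchyCoeff_le_div n hr0 hr hr1 hρ hε hf h hfε
  have hmain := two_pi_I_mul_eq_sub_circleIntegral hr0 hr hrz hzs hs hf
  have hnorm : ‖2 * π * Complex.I * f z‖ = 2 * π * ‖f z‖ := by
    simp [abs_of_pos Real.pi_pos]
  have hle := (hnorm.symm.trans (congrArg norm hmain)).le.trans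
    ((norm_sub_le _ _).trans (add_le_add houter hinner))
  refine le_of_mul_le_mul_left (hle.trans_eq ?_) (mul_pos two_pos Real.pi_pos)
  ring

theorem exists_norm_le_mul_rpow {ρ : ℝ} {z : ℂ} (hρ0 : 0 < ρ) (hρ1 : ρ < 1) (hz : √ρ < ‖z‖)
    (hz1 : ‖z‖ < 1) : ∃ C : ℝ, 0 < C ∧ ∀ ε : ℝ, 0 < ε → ∀ f ∈ symHardySpace ρ,
      hardyNorm ρ f ≤ 1 → circleL2Norm (√ρ) f ≤ ENNReal.ofReal ε →
      ‖f z‖ ≤ C * ε ^ exponent ρ z := by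
  have hg0 := exponent_pos hρ0 hρ1 hz hz1
  have hg1 := exponent_lt_one hρ0 hρ1 hz
  have hzp := sqrt_rpow_exponent hρ0 hρ1 hz
  have hr0 : 0 < √ρ := Real.sqrt_pos.2 hρ0
  have hr1 : √ρ < 1 := hz.trans hz1
  have hr : ρ < √ρ := Real.lt_sqrt_of_sq_lt (by nlinarith)
  set γ := exponent ρ z
  have hb1 : √ρ ^ γ < 1 := hzp ▸ hz1
  have hc1 : √ρ ^ (1 - γ) < 1 := Real.rpow_lt_one hr0.le hr1 (by linarith)
  have hb : 0 < (1 - √ρ ^ γ)⁻¹ := inv_pos.2 (by linarith)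
  have hc : 0 < (1 - √ρ ^ (1 - γ))⁻¹ := inv_pos.2 (by linarith)
  have hd : 0 < (‖z‖ - √ρ)⁻¹ := inv_pos.2 (by linarith)
  refine ⟨2 * (√ρ)⁻¹ * ((1 - √ρ ^ (1 - γ))⁻¹ + (1 - √ρ ^ γ)⁻¹) + (‖z‖ - √ρ)⁻¹, by positivity,
    fun ε hε f hf h hfε => ?_⟩
  -- For `ε > 1` the case `ε = 1` suffices: the Hardy norm already bounds the norm on the middle
  -- circle by `1`.
  wlog hε1 : ε ≤ 1 generalizing ε
  · refine (this 1 one_pos (circleL2Norm_le_of_hardyNorm_le h hr hr1) le_rfl).trans ?_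
    gcongr
    exact (not_le.1 hε1).le
  have hp : 0 < ε ^ γ := Real.rpow_pos_of_pos hε _
  refine (norm_le_of_hardyNorm_le hr0 hr hz hz1 hρ0 hε hf.1.1.differentiableOn h hfε).trans ?_
  have hsum := tsum_rpow_pow_div_le hr0 hr1 hg0 hg1 hε hε1
  rw [hzp] at hsum
  rw [add_mul, mul_assoc (2 * (√ρ)⁻¹), hzp]
  refine add_le_add (mul_le_mul_of_nonneg_left ?_ (by positivity))
    (mul_le_mul_of_nonneg_left ?_ hd.le)
  · calc _ ≤ ε * (((1 - √ρ ^ (1 - γ))⁻¹ + (1 - ‖z‖)⁻¹) * ε ^ (γ - 1)) := by gcongr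
      _ = _ := by rw [Real.rpow_sub_one hε.ne', mul_comm, mul_assoc, div_mul_cancel₀ _ hε.ne']
  · simpa using Real.rpow_le_rpow_of_exponent_ge hε hε1 hg1.le

end AnnulusSymm

theorem mainTheorem6 (ρ : ℝ) (hρ0 : 0 < ρ) (hρ1 : ρ < 1)
    (z : ℂ) (hz : √ρ < ‖z‖) (hz1 : ‖z‖ < 1) :
    -- the upper bound
    (∃ C : ℝ, 0 < C ∧ ∀ ε : ℝ, 0 < ε → ∀ f ∈ AnnulusSymm.symHardySpace ρ,
      AnnulusSymm.hardyNorm ρ f ≤ 1 →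
      AnnulusSymm.circleL2Norm (√ρ) f ≤ ENNReal.ofReal ε →
      ‖f z‖ ≤ C * ε ^ AnnulusSymm.exponent ρ z) ∧
    -- the bound is asymptotically optimal as `ε → 0`
    (∃ c : ℝ, 0 < c ∧ ∀ ε : ℝ, 0 < ε → ε ≤ 1 → ∃ f ∈ AnnulusSymm.symHardySpace ρ,
      AnnulusSymm.hardyNorm ρ f ≤ 1 ∧
      AnnulusSymm.circleL2Norm (√ρ) f ≤ ENNReal.ofReal ε ∧
      c * ε ^ AnnulusSymm.exponent ρ z ≤ ‖f z‖) ∧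
    -- the series of the extremal function converges on the annulus, its sum is in the space
    (∀ ε : ℝ, 0 < ε →
      (∀ ζ ∈ AnnulusSymm.annulus ρ,
        Summable fun n : ℕ => AnnulusSymm.extremalTerm ρ z ε (n + 1) ζ) ∧
      AnnulusSymm.extremal ρ z ε ∈ AnnulusSymm.symHardySpace ρ) ∧
    -- the extremal function attains the bound, with constants independent of `ε`
    (∃ c C : ℝ, 0 < c ∧ 0 < C ∧ ∀ ε : ℝ, 0 < ε → ε ≤ 1 →
      AnnulusSymm.hardyNorm ρ (AnnulusSymm.extremal ρ z ε) ≤ ENNReal.ofReal C ∧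
      AnnulusSymm.circleL2Norm (√ρ) (AnnulusSymm.extremal ρ z ε) ≤ ENNReal.ofReal (C * ε) ∧
      c * ε ^ AnnulusSymm.exponent ρ z ≤ ‖AnnulusSymm.extremal ρ z ε z‖ ∧
      ‖AnnulusSymm.extremal ρ z ε z‖ ≤ C * ε ^ AnnulusSymm.exponent ρ z) := by
  obtain ⟨c, C, hc, hC, hb⟩ := AnnulusSymm.exists_extremal_bounds hρ0 hρ1 hz hz1
  refine ⟨AnnulusSymm.exists_norm_le_mul_rpow hρ0 hρ1 hz hz1,
    ⟨C⁻¹ * c, by positivity, fun ε hε hε1 => ?_⟩,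
    fun ε hε => ⟨fun ζ hζ => AnnulusSymm.summable_extremalTerm hρ0 hz hz1 hε hζ.2.le
      (AnnulusSymm.div_norm_le_one_of_mem_annulus hρ0 hζ) le_rfl,
      AnnulusSymm.extremal_mem_symHardySpace hρ0 hz hz1 hε⟩, c, C, hc, hC, hb⟩
  obtain ⟨h1, h2, h3, -⟩ := hb ε hε hε1
  exact AnnulusSymm.exists_mem_symHardySpace_of_extremal_bounds hρ0 hz hz1 hε hC h1 h2 h3
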